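/- For $x\in(0,1]$ let $U(x)$ be the set of all bases $q\in(1,2]$ for which there is exactly one sequence $(d_i)_{i\ge1}$ with $d_i\in\{0,1\}$ and $$x=\sum_{i=1}^\infty \frac{d_i}{q^i}.$$ For every $x\in(0,1]$ and every real $\lambda\neq0$, both the algebraic sum $$U(x)+\lambda U(x):=\{p+\lambda q:\ p,q\in U(x)\}$$ and the algebraic product $$U(x)\cdot U(x)^\lambda:=\{p\,q^\lambda:\ p,q\in U(x)\}$$ contain a non-degenerate interval, that is, each of them contains a closed interval $[a,b]$ with $a<b$. -/

import Mathlib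

/-- `d` is a `q`-expansion of `x`: the digits are `0` or `1` and `x = ∑_{i ≥ 1} d_i / q ^ i`.
The digit `d_i` with `i ≥ 1` is stored as `d (i - 1)`. -/
def IsExpansion (q x : ℝ) (d : ℕ → Fin 2) : Prop :=
  HasSum (fun i : ℕ => ((d i : ℕ) : ℝ) / q ^ (i + 1)) x

/-- The set of univoque bases of `x`: the bases `q ∈ (1, 2]` in which `x` has exactly one
expansion with digits `0` and `1`. -/
def univoqueBases (x : ℝ) : Set ℝ :=
  {q : ℝ | 1 < q ∧ q ≤ 2 ∧ ∃! d : ℕ → Fin 2, IsExpansion q x d}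

/-- The algebraic sum `A + l * A`; the two elements of `A` are chosen independently. -/
def algebraicSum (A : Set ℝ) (l : ℝ) : Set ℝ :=
  {z : ℝ | ∃ p ∈ A, ∃ q ∈ A, z = p + l * q}

/-- The algebraic product `A · A ^ l` (real power), used only for sets `A` of positive numbers;
the two elements of `A` are chosen independently. -/
noncomputable def algebraicProduct (A : Set ℝ) (l : ℝ) : Set ℝ :=
  {z : ℝ | ∃ p ∈ A, ∃ q ∈ A, z = p * q ^ l}

/-!
For `q` close to `2`, a digit sequence is the only expansion of its value in base `q` as soon as
every tail after a digit `0` has value less than `1` and every tail after a digit `1` has value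
more than `(2 - q) / (q - 1)` (`eq_of_expVal_eq`); the second bound is close to `0`. Thus only long
runs of equal digits are forbidden, and `univoqueBases x` should contain Cantor sets which are
as thick as desired. Sums of thick Cantor sets contain intervals, by an argument of Newhouse.

To construct such a Cantor set, let `t` be the binary expansion of `x` with infinitely many digits
`1`. Consider the expansions which start with `t_0 ⋯ t_(m-1) 0`, where `t_m = 1`, and go on with
arbitrary blocks of `k` digits other than `0 ⋯ 0` and `1 ⋯ 1`. In base `2` their values are smaller
than `x` by at most `2 ^ (-m)`, hence each of them is an expansion of `x` in a base in
`[2 - 2 / (x 2 ^ m), 2]` (`Setup.exists_root`). For suitable `m` these bases are univoque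
(`Setup.IsRoot.mem_univoqueBases`). In the prefix, the tails are smaller than those of `t` in base
`2`, so they are less than `1`, and after each digit `1` of the prefix the next one comes early
enough to compensate for `2 - q` of order `2 ^ (-m)`.

Two such bases `q ≤ q'`, with expansions `d` and `d'`, satisfy
`(x / 2) (q' - q) ≤ expVal d' q - x ≤ 4 (q' - q)` (`Setup.IsRoot.sub_le`,
`Setup.IsRoot.le_sub`), so that lengths of intervals of bases can be read off from the digits. An
interval of bases with given first blocks splits into `2 ^ k - 2` subintervals, one for each
choice of the next block. Relative to the interval, up to factors depending only on `x`, the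
subintervals have length `2 ^ (-k)` and the gaps between neighbours length `4 ^ (-k)`
(`Setup.interval_length`, `Setup.gap_le`). For large `k` the gaps are negligible, and this remains
true for the image under the logarithm, which turns products into sums (`Setup.isThick`).

Finally, if a point lies in the sum of two intervals of comparable lengths from such families, then
the longer one can be replaced by one of its subintervals, since the shorter one is longer than
the gaps. Iterating this, the point is a limit of sums of endpoints (`IsThick.approx_add`), hence
a sum of two points of the Cantor sets by compactness.
-/

/-! ### Sums of thick families of intervals -/

/-- A family of intervals `[f w, g w]` is `ρ`-thick if, whenever `h` is at least `ρ` times the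
length of `[f w, g w]`, each point of `[f w, g w] + [0, h]` lies in `[f w', g w'] + [0, h]` for an
interval `[f w', g w']` of the family which is shorter by a factor between `ρ` and `1 / 2`. -/
structure IsThick {W : Type*} (ρ : ℝ) (f g : W → ℝ) : Prop where
  lt : ∀ w, f w < g w
  cover : ∀ w s h, ρ * (g w - f w) ≤ h → f w ≤ s → s ≤ g w + h →
    ∃ w', f w' ≤ s ∧ s ≤ g w' + h ∧ ρ * (g w - f w) ≤ g w' - f w' ∧ g w' - f w' ≤ (g w - f w) / 2

namespace IsThick

variable {W W' : Type*} {ρ : ℝ} {f g : W → ℝ} {f' g' : W' → ℝ}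

theorem const_mul (H : IsThick ρ f g) {c : ℝ} (hc : 0 < c) :
    IsThick ρ (fun w => c * f w) (fun w => c * g w) where
  lt w := mul_lt_mul_of_pos_left (H.lt w) hc
  cover w s h hh h1 h2 := by
    obtain ⟨w', a1, a2, a3, a4⟩ := H.cover w (s / c) (h / c)
      (by rw [le_div_iff₀ hc]; linarith) (by rw [le_div_iff₀ hc]; linarith)
      (by rw [← sub_nonneg]; have : 0 ≤ (c * g w + h - s) / c := by
            apply div_nonneg _ hc.le; linarith
          convert this using 1; field_simp)
    rw [le_div_iff₀ hc] at a1
    have a2' : s ≤ c * g w' + h := by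
      rw [div_le_iff₀ hc, add_mul, div_mul_cancel₀ _ hc.ne'] at a2; linarith
    refine ⟨w', by linarith, a2', ?_, ?_⟩
    · have := mul_le_mul_of_nonneg_left a3 hc.le; linarith
    · have := mul_le_mul_of_nonneg_left a4 hc.le; linarith

theorem neg (H : IsThick ρ f g) : IsThick ρ (fun w => -g w) (fun w => -f w) where
  lt w := neg_lt_neg (H.lt w)
  cover w s h hh h1 h2 := by
    obtain ⟨w', a1, a2, a3, a4⟩ := H.cover w (h - s) h (by linarith) (by linarith) (by linarith)
    exact ⟨w', by linarith, by linarith, by linarith, by linarith⟩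

/-- Intervals of a thick family reach every scale, up to the factor `ρ`. -/
theorem exists_scale (H : IsThick ρ f g) (h0 : 0 < ρ) (h1 : ρ ≤ 1) (w : W) {τ : ℝ} (hτ : 0 < τ)
    (hw : τ ≤ g w - f w) : ∃ v, ρ * τ ≤ g v - f v ∧ g v - f v ≤ τ := by
  by_contra! hcon
  have key : ∀ n : ℕ, ∃ v, τ ≤ g v - f v ∧ g v - f v ≤ (g w - f w) * (1 / 2) ^ n := by
    intro n
    induction n with
    | zero => exact ⟨w, hw, by simp⟩
    | succ n ih =>
      obtain ⟨v, hv1, hv2⟩ := ih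
      have hlt := H.lt v
      obtain ⟨u, _, _, u1, u2⟩ := H.cover v (f v) (g v - f v) (by nlinarith) le_rfl (by linarith)
      refine ⟨u, ?_, ?_⟩
      · have := hcon u (by nlinarith)
        exact this.le
      · rw [pow_succ]; linarith
  have hlim : Filter.Tendsto (fun n : ℕ => (g w - f w) * (1 / 2 : ℝ) ^ n) Filter.atTop
      (nhds ((g w - f w) * 0)) :=
    (tendsto_pow_atTop_nhds_zero_of_lt_one (by norm_num) (by norm_num)).const_mul _
  rw [mul_zero] at hlim
  obtain ⟨n, hn⟩ := (hlim.eventually (gt_mem_nhds hτ)).exists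
  obtain ⟨v, hv1, hv2⟩ := key n
  linarith

/-- If two intervals of thick families have comparable lengths, then every point of their sum is
approximated by sums of left endpoints: replacing the longer of the two intervals by a
shorter one keeps the lengths comparable and the point in the sum. -/
theorem approx_add (H : IsThick ρ f g) (H' : IsThick ρ f' g') (h0 : 0 < ρ)
    {w : W} {v : W'} (hwv : ρ * (g w - f w) ≤ g' v - f' v) (hvw : ρ * (g' v - f' v) ≤ g w - f w)
    {s : ℝ} (hs1 : f w + f' v ≤ s) (hs2 : s ≤ g w + g' v) {ε : ℝ} (hε : 0 < ε) :
    ∃ w v, |s - (f w + f' v)| < ε := by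
  have key : ∀ n : ℕ, ∃ w' v', ρ * (g w' - f w') ≤ g' v' - f' v' ∧
      ρ * (g' v' - f' v') ≤ g w' - f w' ∧ f w' + f' v' ≤ s ∧ s ≤ g w' + g' v' ∧
      (g w' - f w') * (g' v' - f' v') ≤ (g w - f w) * (g' v - f' v) * (1 / 2) ^ n := by
    intro n
    induction n with
    | zero => exact ⟨w, v, hwv, hvw, hs1, hs2, by simp⟩
    | succ n ih =>
      obtain ⟨w', v', a1, a2, a3, a4, a5⟩ := ih
      have hw' := H.lt w'
      have hv' := H'.lt v'
      rcases le_total (g' v' - f' v') (g w' - f w') with hle | hle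
      · obtain ⟨u, u1, u2, u3, u4⟩ := H.cover w' (s - f' v') (g' v' - f' v') a1 (by linarith)
          (by linarith)
        refine ⟨u, v', by nlinarith, by nlinarith, by linarith, by linarith, ?_⟩
        rw [pow_succ]
        nlinarith
      · obtain ⟨u, u1, u2, u3, u4⟩ := H'.cover v' (s - f w') (g w' - f w') a2 (by linarith)
          (by linarith)
        refine ⟨w', u, by nlinarith, by nlinarith, by linarith, by linarith, ?_⟩
        rw [pow_succ]
        nlinarith
  set P := (g w - f w) * (g' v - f' v)
  have hlim : Filter.Tendsto (fun n : ℕ => P * (1 / 2 : ℝ) ^ n) Filter.atTop (nhds (P * 0)) :=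
    (tendsto_pow_atTop_nhds_zero_of_lt_one (by norm_num) (by norm_num)).const_mul _
  rw [mul_zero] at hlim
  obtain ⟨n, hn⟩ := (hlim.eventually (gt_mem_nhds (show 0 < ρ * ε ^ 2 / 4 by positivity))).exists
  obtain ⟨w', v', a1, a2, a3, a4, a5⟩ := key n
  refine ⟨w', v', ?_⟩
  have hw' := H.lt w'
  have hv' := H'.lt v'
  rw [abs_of_nonneg (by linarith)]
  set a := g w' - f w'
  set b := g' v' - f' v'
  have ha : 0 < a := sub_pos.2 hw'
  have hb : 0 < b := sub_pos.2 hv'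
  have hab : a + b < ε := by
    by_contra! hc
    -- `(a + b)² ≤ 2 (a² + b²)`, where both `ρ a²` and `ρ b²` are at most `a b`
    have e1 : ε ^ 2 ≤ (a + b) ^ 2 := pow_le_pow_left₀ hε.le hc 2
    have e2 : (a + b) ^ 2 ≤ 2 * a ^ 2 + 2 * b ^ 2 := by nlinarith [sq_nonneg (a - b)]
    have e3 : ρ * a ^ 2 ≤ a * b := by nlinarith
    have e4 : ρ * b ^ 2 ≤ a * b := by nlinarith
    have e5 : ρ * ε ^ 2 ≤ ρ * (2 * a ^ 2 + 2 * b ^ 2) :=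
      mul_le_mul_of_nonneg_left (e1.trans e2) h0.le
    linarith
  have : s - (f w' + f' v') ≤ a + b := by simp only [a, b]; linarith
  linarith

/-- The sum of two compact sets containing the endpoints of thick families with comparable
intervals contains an interval. -/
theorem exists_Icc_subset_add (H : IsThick ρ f g) (H' : IsThick ρ f' g') (h0 : 0 < ρ)
    (h1 : ρ ≤ 1) {A B : Set ℝ} (hA : IsCompact A) (hB : IsCompact B) (hf : ∀ w, f w ∈ A)
    (hf' : ∀ v, f' v ∈ B) (w : W) (v : W') :
    ∃ a b, a < b ∧ ∀ s ∈ Set.Icc a b, ∃ p ∈ A, ∃ q ∈ B, s = p + q := by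
  obtain ⟨w, v, hwv, hvw⟩ : ∃ w v, ρ * (g w - f w) ≤ g' v - f' v ∧
      ρ * (g' v - f' v) ≤ g w - f w := by
    have hw := H.lt w
    have hv := H'.lt v
    rcases le_total (g' v - f' v) (g w - f w) with hle | hle
    · obtain ⟨u, u1, u2⟩ := H.exists_scale h0 h1 w (sub_pos.2 hv) hle
      exact ⟨u, v, by nlinarith [H.lt u], u1⟩
    · obtain ⟨u, u1, u2⟩ := H'.exists_scale h0 h1 v (sub_pos.2 hw) hle
      exact ⟨w, u, u1, by nlinarith [H'.lt u]⟩
  refine ⟨f w + f' v, g w + g' v, add_lt_add (H.lt w) (H'.lt v), fun s hs => ?_⟩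
  open Pointwise in
  have hcl : s ∈ closure (A + B) := by
    rw [Metric.mem_closure_iff]
    intro ε hε
    obtain ⟨w', v', hd⟩ := H.approx_add H' h0 hwv hvw hs.1 hs.2 hε
    exact ⟨_, Set.add_mem_add (hf w') (hf' v'), by rwa [Real.dist_eq]⟩
  rw [(hA.add hB).isClosed.closure_eq] at hcl
  obtain ⟨p, hp, q, hq, rfl⟩ := hcl
  exact ⟨p, hp, q, hq, rfl⟩

end IsThick

/-! ### Values of digit sequences -/

/-- The value `∑ d i / q ^ (i + 1)` of the digit sequence `d` in base `q`; its summands are indexed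
from `i = 0` as in `IsExpansion`. -/
noncomputable def expVal (d : ℕ → Fin 2) (q : ℝ) : ℝ :=
  ∑' i : ℕ, ((d i : ℕ) : ℝ) / q ^ (i + 1)

theorem digit_le_one (a : Fin 2) : ((a : ℕ) : ℝ) ≤ 1 := by
  exact_mod_cast Nat.lt_succ_iff.1 a.2

theorem hasSum_one_div_pow_succ {q : ℝ} (hq : 1 < q) :
    HasSum (fun i : ℕ => 1 / q ^ (i + 1)) (1 / (q - 1)) := by
  have h0 : 0 < q := by linarith
  have h := (hasSum_geometric_of_lt_one (inv_nonneg.2 h0.le) (inv_lt_one_of_one_lt₀ hq)).mul_left q⁻¹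
  have e : q⁻¹ * (1 - q⁻¹)⁻¹ = 1 / (q - 1) := by
    have : q - 1 ≠ 0 := by linarith
    have h2 : 1 - q⁻¹ ≠ 0 := by
      rw [sub_ne_zero]; exact (inv_lt_one_of_one_lt₀ hq).ne'
    field_simp
  rw [e] at h
  have hfun : (fun i : ℕ => 1 / q ^ (i + 1)) = fun i => q⁻¹ * q⁻¹ ^ i := by
    funext i
    rw [pow_succ, inv_pow, one_div, mul_inv, mul_comm]
  rwa [hfun]

theorem digit_div_le {q : ℝ} (hq : 1 < q) (a : Fin 2) (i : ℕ) :
    ((a : ℕ) : ℝ) / q ^ (i + 1) ≤ 1 / q ^ (i + 1) :=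
  div_le_div_of_nonneg_right (digit_le_one a) (by positivity)

theorem summable_expVal (d : ℕ → Fin 2) {q : ℝ} (hq : 1 < q) :
    Summable (fun i : ℕ => ((d i : ℕ) : ℝ) / q ^ (i + 1)) :=
  Summable.of_nonneg_of_le (fun i => by positivity) (fun i => digit_div_le hq _ i)
    (hasSum_one_div_pow_succ hq).summable

theorem isExpansion_iff {q x : ℝ} (hq : 1 < q) {d : ℕ → Fin 2} :
    IsExpansion q x d ↔ expVal d q = x :=
  (summable_expVal d hq).hasSum_iff

theorem expVal_nonneg (d : ℕ → Fin 2) {q : ℝ} (hq : 1 < q) : 0 ≤ expVal d q :=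
  tsum_nonneg fun i => by positivity

theorem expVal_le (d : ℕ → Fin 2) {q : ℝ} (hq : 1 < q) : expVal d q ≤ 1 / (q - 1) := by
  rw [← (hasSum_one_div_pow_succ hq).tsum_eq]
  exact (summable_expVal d hq).tsum_le_tsum (fun i => digit_div_le hq _ i)
    (hasSum_one_div_pow_succ hq).summable

theorem expVal_split (d : ℕ → Fin 2) {q : ℝ} (hq : 1 < q) (n : ℕ) :
    expVal d q = ∑ i ∈ Finset.range n, ((d i : ℕ) : ℝ) / q ^ (i + 1) +
      expVal (fun i => d (n + i)) q / q ^ n := by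
  rw [expVal, ← (summable_expVal d hq).sum_add_tsum_nat_add n, expVal, ← tsum_div_const]
  congr 1
  refine tsum_congr fun i => ?_
  rw [div_div, ← pow_add, Nat.add_comm i n]
  congr 2
  ring

theorem expVal_succ (d : ℕ → Fin 2) {q : ℝ} (hq : 1 < q) (n : ℕ) :
    q * expVal (fun i => d (n + i)) q = (d n : ℕ) + expVal (fun i => d (n + 1 + i)) q := by
  rw [expVal_split _ hq 1]
  have : q ≠ 0 := by positivity
  simp only [Finset.sum_range_one, ← add_assoc]
  field_simp
  simp
  ring

/-- A digit `1` bounds the value from below. -/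
theorem one_div_pow_le_expVal (d : ℕ → Fin 2) {q : ℝ} (hq : 1 < q) {j : ℕ} (hj : d j = 1) :
    1 / q ^ (j + 1) ≤ expVal d q := by
  have := (summable_expVal d hq).le_tsum j (fun i _ => by positivity)
  simpa [hj, expVal] using this

/-- A digit `0` bounds the value away from its maximum `1 / (q - 1)`. -/
theorem expVal_le_sub (d : ℕ → Fin 2) {q : ℝ} (hq : 1 < q) {j : ℕ} (hj : d j = 0) :
    expVal d q ≤ 1 / (q - 1) - 1 / q ^ (j + 1) := by
  have hs := hasSum_one_div_pow_succ hq
  have h1 := (hs.summable.sub (summable_expVal d hq)).le_tsum j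
    (fun i _ => sub_nonneg.2 (digit_div_le hq _ i))
  rw [hs.summable.tsum_sub (summable_expVal d hq), hs.tsum_eq] at h1
  simp only [hj] at h1
  change _ ≤ _ - expVal d q at h1
  simp at h1
  simp
  linarith

theorem mul_expVal_le (d : ℕ → Fin 2) {p q : ℝ} (hp : 1 < p) (hpq : p ≤ q) :
    q * expVal d q ≤ p * expVal d p := by
  rw [expVal, expVal, ← tsum_mul_left, ← tsum_mul_left]
  refine Summable.tsum_le_tsum (fun i => ?_) ((summable_expVal d (hp.trans_le hpq)).mul_left _)
    ((summable_expVal d hp).mul_left _)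
  have e : ∀ r : ℝ, 1 < r → r * (((d i : ℕ) : ℝ) / r ^ (i + 1)) = ((d i : ℕ) : ℝ) / r ^ i := by
    intro r hr
    have : r ≠ 0 := by positivity
    field_simp
    ring
  rw [e _ hp, e _ (hp.trans_le hpq)]
  gcongr

theorem expVal_anti (d : ℕ → Fin 2) {p q : ℝ} (hp : 1 < p) (hpq : p ≤ q) :
    expVal d q ≤ expVal d p := by
  have h := mul_expVal_le d hp hpq
  have h0 := expVal_nonneg d (hp.trans_le hpq)
  by_contra! hc
  nlinarith

/-- If all digits are `1`, the difference of the values is `1 / (p - 1) - 1 / (q - 1)`; replacing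
digits by `0` can only decrease it. -/
theorem expVal_sub_le (d : ℕ → Fin 2) {p q : ℝ} (hp : 3 / 2 ≤ p) (hpq : p ≤ q) :
    expVal d p - expVal d q ≤ 4 * (q - p) := by
  have hp1 : 1 < p := by linarith
  have hq1 : 1 < q := by linarith
  have hs := (hasSum_one_div_pow_succ hp1).sub (hasSum_one_div_pow_succ hq1)
  have h1 : expVal d p - expVal d q ≤ 1 / (p - 1) - 1 / (q - 1) := by
    rw [← hs.tsum_eq, expVal, expVal,
      ← (summable_expVal d hp1).tsum_sub (summable_expVal d hq1)]
    refine Summable.tsum_le_tsum (fun i => ?_)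
      ((summable_expVal d hp1).sub (summable_expVal d hq1)) hs.summable
    have h : 1 / q ^ (i + 1) ≤ 1 / p ^ (i + 1) := by gcongr
    have e := digit_le_one (d i)
    rw [div_eq_mul_one_div _ (p ^ (i + 1)), div_eq_mul_one_div _ (q ^ (i + 1)), ← mul_sub]
    exact mul_le_of_le_one_left (sub_nonneg.2 h) e
  refine h1.trans ?_
  rw [div_sub_div _ _ (by linarith) (by linarith), div_le_iff₀ (by nlinarith)]
  have : 1 ≤ 4 * ((p - 1) * (q - 1)) := by nlinarith
  nlinarith

theorem continuousOn_expVal (d : ℕ → Fin 2) : ContinuousOn (expVal d) (Set.Ici (3 / 2)) := by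
  refine LipschitzOnWith.continuousOn (K := 4) (LipschitzOnWith.of_le_add_mul 4 ?_)
  intro p hp q hq
  rw [Real.dist_eq]
  rcases le_total p q with h | h
  · have := expVal_sub_le d hp h
    rw [abs_of_nonpos (by linarith)]
    push_cast
    linarith
  · have := expVal_anti d (show 1 < q by have := Set.mem_Ici.1 hq; linarith) h
    have := abs_nonneg (p - q)
    push_cast
    linarith

/-- A digit sequence whose tails stay off the region where both digits are possible is the only
expansion of its value. -/
theorem eq_of_expVal_eq {q : ℝ} (hq : 1 < q) {d d' : ℕ → Fin 2}
    (h0 : ∀ n, d n = 0 → expVal (fun i => d (n + 1 + i)) q < 1)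
    (h1 : ∀ n, d n = 1 → (2 - q) / (q - 1) < expVal (fun i => d (n + 1 + i)) q)
    (h : expVal d' q = expVal d q) : d' = d := by
  have step : ∀ n, expVal (fun i => d' (n + i)) q = expVal (fun i => d (n + i)) q →
      d' n = d n := by
    intro n hn
    have e := expVal_succ d hq n
    have e' := expVal_succ d' hq n
    rw [hn] at e'
    have p' := expVal_nonneg (fun i => d' (n + 1 + i)) hq
    have b' := expVal_le (fun i => d' (n + 1 + i)) hq
    have hid : 1 / (q - 1) = 1 + (2 - q) / (q - 1) := by
      have : q - 1 ≠ 0 := by linarith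
      field_simp
      ring
    have c0 := h0 n
    have c1 := h1 n
    generalize d n = a at *
    generalize d' n = a' at *
    fin_cases a <;> fin_cases a' <;> simp at *
    · linarith
    · linarith
  have tails : ∀ n, expVal (fun i => d' (n + i)) q = expVal (fun i => d (n + i)) q := by
    intro n
    induction n with
    | zero => simpa using h
    | succ n ih =>
      have e := expVal_succ d hq n
      have e' := expVal_succ d' hq n
      rw [ih, step n ih] at e'
      linarith
  funext n
  exact step n (tails n)

/-! ### Binary expansions and the choice of parameters -/

/-- The quasi-greedy binary expansion `t` of `x`, with its tails `y`; it has infinitely many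
digits `1` even if `x` is dyadic. -/
theorem exists_binary {x : ℝ} (hx0 : 0 < x) (hx1 : x ≤ 1) :
    ∃ (t : ℕ → Fin 2) (y : ℕ → ℝ), y 0 = x ∧ (∀ n, 0 < y n) ∧ (∀ n, y n ≤ 1) ∧
      (∀ n, y (n + 1) = 2 * y n - (t n : ℕ)) ∧ (∀ n, t n = 1 → 1 / 2 < y n) ∧
      ∀ N, ∃ n ≥ N, t n = 1 := by
  let dg : ℝ → Fin 2 := fun z => if (1 / 2 : ℝ) < z then 1 else 0
  let y : ℕ → ℝ := fun n => Nat.rec x (fun _ z => 2 * z - (dg z : ℕ)) n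
  have hy : ∀ n, y (n + 1) = 2 * y n - (dg (y n) : ℕ) := fun n => rfl
  have dg_one : ∀ z, 1 / 2 < z → dg z = 1 := fun z hz => if_pos hz
  have dg_zero : ∀ z, z ≤ 1 / 2 → dg z = 0 := fun z hz => if_neg hz.not_gt
  have hb : ∀ n, 0 < y n ∧ y n ≤ 1 := by
    intro n
    induction n with
    | zero => exact ⟨hx0, hx1⟩
    | succ n ih =>
      rw [hy]
      rcases lt_or_ge (1 / 2) (y n) with h | h
      · rw [dg_one _ h]
        norm_num
        constructor <;> linarith
      · rw [dg_zero _ h]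
        norm_num
        constructor <;> linarith
  refine ⟨fun n => dg (y n), y, rfl, fun n => (hb n).1, fun n => (hb n).2, hy, ?_, ?_⟩
  · intro n hn
    by_contra! h
    change dg (y n) = 1 at hn
    rw [dg_zero _ h] at hn
    exact absurd hn (by decide)
  · -- otherwise the tails `y n` would double for ever
    intro N
    by_contra! hN
    have h0 : ∀ n ≥ N, dg (y n) = 0 := fun n hn => by
      have := hN n hn
      generalize dg (y n) = a at *
      fin_cases a
      · rfl
      · exact absurd rfl this
    have key : ∀ j, y (N + j) = 2 ^ j * y N := by
      intro j
      induction j with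
      | zero => simp
      | succ j ih =>
        rw [← add_assoc, hy, h0 _ (Nat.le_add_right _ _), ih, pow_succ]
        simp
        ring
    obtain ⟨j, hj⟩ := pow_unbounded_of_one_lt (1 / y N) (one_lt_two (α := ℝ))
    rw [div_lt_iff₀ (hb N).1, ← key] at hj
    linarith [(hb (N + j)).2]

/-- Parameters of a thick subset of `univoqueBases x`. The expansions used are
`t_0 ⋯ t_(m-1) 0` followed by nonconstant blocks of `k` digits, where `t` is a binary expansion
of `x` with tails `y`. The corresponding bases lie in `[2 - eps, 2]`. The field `tail` makes the
prefix compatible with unique expansions in these bases: after a digit `1` of the prefix, the next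
digit `1` comes early enough. -/
structure Setup (x : ℝ) where
  x_pos : 0 < x
  x_le : x ≤ 1
  t : ℕ → Fin 2
  y : ℕ → ℝ
  k : ℕ
  m : ℕ
  eps : ℝ
  eps_eq : eps = 2 / (x * 2 ^ m)
  y_zero : y 0 = x
  y_pos : ∀ n, 0 < y n
  y_le : ∀ n, y n ≤ 1
  y_succ : ∀ n, y (n + 1) = 2 * y n - (t n : ℕ)
  half_lt : 1 / 2 < y m
  hk : 2 ^ 18 ≤ 2 ^ k * x ^ 2
  eps_le : eps ≤ (1 / 8) ^ k
  large : ∀ N ≥ m, 8 * N ≤ x * (3 / 2) ^ N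
  tail : ∀ n < m, t n = 1 →
    (∃ j, n < j ∧ j < m ∧ t j = 1 ∧ 2 * eps < (1 / 2) ^ (j - n)) ∨
      2 * eps < (1 / 2) ^ (m + k - n)

theorem Setup.exists {x : ℝ} (hx0 : 0 < x) (hx1 : x ≤ 1) : Nonempty (Setup x) := by
  obtain ⟨t, y, y0, ypos, yle, ysucc, yhalf, hinf⟩ := exists_binary hx0 hx1
  obtain ⟨k, hk⟩ := pow_unbounded_of_one_lt (2 ^ 18 / x ^ 2) (one_lt_two (α := ℝ))
  obtain ⟨N, hN⟩ := pow_unbounded_of_one_lt (4 * 2 ^ k / x) (one_lt_two (α := ℝ))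
  obtain ⟨M, hMN, hM⟩ := hinf N
  have heps : Filter.Tendsto (fun m : ℕ => 2 / (x * 2 ^ m)) Filter.atTop (nhds 0) := by
    have := (tendsto_pow_atTop_nhds_zero_of_lt_one (r := (1 / 2 : ℝ)) (by norm_num)
      (by norm_num)).const_mul (2 / x)
    rw [mul_zero] at this
    refine this.congr fun m => ?_
    rw [one_div, inv_pow]
    field_simp
  have hlin : Filter.Tendsto (fun n : ℕ => (n : ℝ) * (2 / 3) ^ n) Filter.atTop (nhds 0) :=
    tendsto_self_mul_const_pow_of_lt_one (by norm_num) (by norm_num)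
  have e1 := heps.eventually (gt_mem_nhds (show (0 : ℝ) < (1 / 8) ^ k by positivity))
  have e2 := heps.eventually (gt_mem_nhds (show (0 : ℝ) < (1 / 2) ^ M / 2 by positivity))
  have e3 := hlin.eventually (gt_mem_nhds (show (0 : ℝ) < x / 8 by positivity))
  obtain ⟨m₀, hm₀⟩ := Filter.eventually_atTop.1 (e1.and (e2.and e3))
  obtain ⟨m, hm, htm⟩ := hinf (max m₀ (M + 1))
  have hm1 : m₀ ≤ m := (le_max_left _ _).trans hm
  have hm2 : M < m := (le_max_right _ _).trans hm
  refine ⟨⟨hx0, hx1, t, y, k, m, _, rfl, y0, ypos, yle, ysucc, yhalf m htm, ?_,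
    (hm₀ m hm1).1.le, ?_, ?_⟩⟩
  · rw [div_lt_iff₀ (by positivity)] at hk
    exact hk.le
  · intro n hn
    have h := (hm₀ n (hm1.trans hn)).2.2
    have e : (2 / 3 : ℝ) ^ n * (3 / 2) ^ n = 1 := by rw [← mul_pow]; norm_num
    have := mul_lt_mul_of_pos_right h (show (0 : ℝ) < (3 / 2) ^ n by positivity)
    rw [mul_assoc, e] at this
    linarith
  · intro n hn htn
    rcases lt_or_ge n M with h | h
    · refine Or.inl ⟨M, h, hm2, hM, ?_⟩
      have h2 := (hm₀ m hm1).2.1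
      have : (1 / 2 : ℝ) ^ M ≤ (1 / 2) ^ (M - n) :=
        pow_le_pow_of_le_one (by norm_num) (by norm_num) (Nat.sub_le _ _)
      linarith
    · right
      have h2 : (2 : ℝ) ^ N ≤ 2 ^ n := pow_le_pow_right₀ (by norm_num) (hMN.trans h)
      have h3 := hN.trans_le h2
      rw [div_lt_iff₀ hx0] at h3
      have e : (1 / 2 : ℝ) ^ (m + k - n) = 2 ^ n / (2 ^ m * 2 ^ k) := by
        rw [one_div, inv_pow, eq_div_iff (by positivity), ← pow_add,
          inv_mul_eq_iff_eq_mul₀ (by positivity), ← pow_add]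
        congr 1
        omega
      rw [e, lt_div_iff₀ (by positivity)]
      have : 2 * (2 / (x * 2 ^ m)) * (2 ^ m * 2 ^ k) = 4 * 2 ^ k / x := by
        field_simp
        norm_num
      rw [this, div_lt_iff₀ hx0]
      exact h3

/-! ### Sequences of blocks -/

/-- The concatenation of the `k`-digit binary representations of `b 0, b 1, …`, each with its
most significant digit first. -/
def blockDigit (k : ℕ) (b : ℕ → ℕ) (i : ℕ) : Fin 2 :=
  ⟨b (i / k) / 2 ^ (k - 1 - i % k) % 2, Nat.mod_lt _ two_pos⟩

/-- The value in base `q` of the `k`-digit binary representation of `u`, read as an integer. -/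
def blockVal (k u : ℕ) (q : ℝ) : ℝ :=
  ∑ j ∈ Finset.range k, ((u / 2 ^ j % 2 : ℕ) : ℝ) * q ^ j

/-- All blocks are nonconstant: the words `0 ⋯ 0` and `1 ⋯ 1` do not occur as blocks. -/
def ValidBlocks (k : ℕ) (b : ℕ → ℕ) : Prop :=
  ∀ j, 1 ≤ b j ∧ b j + 2 ≤ 2 ^ k

theorem sum_div_two_pow_mod (u k : ℕ) :
    ∑ j ∈ Finset.range k, (u / 2 ^ j % 2) * 2 ^ j = u % 2 ^ k := by
  induction k with
  | zero => simp [Nat.mod_one]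
  | succ k ih => rw [Finset.sum_range_succ, ih, Nat.mod_pow_succ]; ring

theorem blockVal_two {k u : ℕ} (hu : u < 2 ^ k) : blockVal k u 2 = u := by
  have h := sum_div_two_pow_mod u k
  rw [Nat.mod_eq_of_lt hu] at h
  conv_rhs => rw [← h]
  simp [blockVal]

theorem exists_digit_one {k u : ℕ} (h0 : 1 ≤ u) (hu : u < 2 ^ k) :
    ∃ r < k, u / 2 ^ r % 2 = 1 := by
  by_contra! h
  have e := sum_div_two_pow_mod u k
  rw [Nat.mod_eq_of_lt hu, Finset.sum_eq_zero] at e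
  · omega
  · intro j hj
    have := h j (Finset.mem_range.1 hj)
    have : u / 2 ^ j % 2 = 0 := by omega
    simp [this]

theorem exists_digit_zero {k u : ℕ} (hu : u + 2 ≤ 2 ^ k) :
    ∃ r < k, u / 2 ^ r % 2 = 0 := by
  by_contra! h
  have e := sum_div_two_pow_mod u k
  rw [Nat.mod_eq_of_lt (by omega), Finset.sum_congr rfl (g := fun j => 2 ^ j)] at e
  · rw [Nat.geomSum_eq le_rfl] at e
    simp at e
    omega
  · intro j hj
    have := h j (Finset.mem_range.1 hj)
    have : u / 2 ^ j % 2 = 1 := by omega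
    simp [this]

theorem blockDigit_add {k : ℕ} (hk : 0 < k) (b : ℕ → ℕ) (n i : ℕ) :
    blockDigit k b (k * n + i) = blockDigit k (fun j => b (n + j)) i := by
  simp only [blockDigit, Nat.mul_add_mod, Nat.mul_add_div hk]

theorem expVal_blockDigit {k : ℕ} (hk : 0 < k) (b : ℕ → ℕ) {q : ℝ} (hq : 1 < q) :
    expVal (blockDigit k b) q =
      (blockVal k (b 0) q + expVal (blockDigit k (fun j => b (j + 1))) q) / q ^ k := by
  rw [expVal_split _ hq k, add_div]
  congr 1
  · rw [blockVal, ← Finset.sum_range_reflect (fun j => ((b 0 / 2 ^ j % 2 : ℕ) : ℝ) * q ^ j),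
      Finset.sum_div]
    refine Finset.sum_congr rfl fun i hi => ?_
    have hi := Finset.mem_range.1 hi
    simp only [blockDigit, Nat.mod_eq_of_lt hi, Nat.div_eq_of_lt hi]
    have e : q ^ k = q ^ (k - 1 - i) * q ^ (i + 1) := by
      rw [← pow_add]; congr 1; omega
    have h0 : q ≠ 0 := by positivity
    rw [e]
    field_simp
  · congr 3
    funext i
    have := blockDigit_add hk b 1 i
    rw [mul_one] at this
    rw [this]
    simp only [add_comm 1]

/-- Every digit occurs at an index between `i` and `i + 2 k - 1`, as these contain a block. -/
theorem exists_blockDigit_eq {k : ℕ} {b : ℕ → ℕ} (hb : ValidBlocks k b) (a : Fin 2) (i : ℕ) :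
    ∃ j < 2 * k, blockDigit k b (i + j) = a := by
  obtain ⟨r, hr, hra⟩ : ∃ r < k, b (i / k + 1) / 2 ^ r % 2 = a := by
    have := hb (i / k + 1)
    fin_cases a
    · exact exists_digit_zero this.2
    · exact exists_digit_one this.1 (by omega)
  have hk : 0 < k := by omega
  have hi := Nat.div_add_mod i k
  have hlt := Nat.mod_lt i hk
  refine ⟨k + (k - 1 - r) - i % k, by omega, ?_⟩
  have e : i + (k + (k - 1 - r) - i % k) = k * (i / k + 1) + (k - 1 - r) := by
    rw [mul_add, mul_one]
    omega
  rw [e, blockDigit_add hk]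
  apply Fin.ext
  have h1 : k - 1 - r < k := by omega
  simp only [blockDigit, Nat.mod_eq_of_lt h1, Nat.div_eq_of_lt h1, add_zero]
  rw [show k - 1 - (k - 1 - r) = r by omega, hra]

/-- A digit `1` occurs in the first block. -/
theorem exists_blockDigit_eq_one {k : ℕ} {b : ℕ → ℕ} (hb : ValidBlocks k b) :
    ∃ j < k, blockDigit k b j = 1 := by
  have h := hb 0
  obtain ⟨r, hr, hra⟩ := exists_digit_one h.1 (k := k) (by omega)
  have h1 : k - 1 - r < k := by omega
  refine ⟨k - 1 - r, h1, Fin.ext ?_⟩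
  simp only [blockDigit, Nat.mod_eq_of_lt h1, Nat.div_eq_of_lt h1]
  rw [show k - 1 - (k - 1 - r) = r by omega, hra]
  rfl

namespace Setup

variable {x : ℝ} (S : Setup x)

theorem k_pos : 0 < S.k := by
  by_contra! h
  have h0 : S.k = 0 := by omega
  have := S.hk
  have h1 := S.x_le
  have h2 := S.x_pos
  rw [h0] at this
  nlinarith

theorem eps_pos : 0 < S.eps := by
  rw [S.eps_eq]
  have := S.x_pos
  positivity

theorem k_mul_eps_le : S.k * S.eps ≤ (1 / 4) ^ S.k := by
  have h : (S.k : ℝ) ≤ 2 ^ S.k := by exact_mod_cast Nat.lt_two_pow_self.le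
  calc (S.k : ℝ) * S.eps ≤ 2 ^ S.k * (1 / 8) ^ S.k :=
        mul_le_mul h S.eps_le S.eps_pos.le (by positivity)
    _ = (1 / 4) ^ S.k := by rw [← mul_pow]; norm_num

theorem eps_le_eighth : S.eps ≤ 1 / 8 :=
  S.eps_le.trans ((pow_le_pow_of_le_one (by norm_num) (by norm_num) S.k_pos).trans
    (by norm_num))

variable {S} {q : ℝ}

theorem three_halves_le (hq : 2 - S.eps ≤ q) : 3 / 2 ≤ q := by
  have := S.eps_le_eighth
  linarith

theorem pow_ge (h1 : 2 - S.eps ≤ q) {j : ℕ} (hj : j ≤ S.k) :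
    2 ^ j * (1 - (1 / 4) ^ S.k) ≤ q ^ j := by
  have he := S.eps_pos
  have hb := one_add_mul_le_pow (a := -(S.eps / 2)) (by linarith [S.eps_le_eighth]) j
  have hq : (2 * (1 + -(S.eps / 2))) ^ j ≤ q ^ j :=
    pow_le_pow_left₀ (by linarith [S.eps_le_eighth]) (by linarith) j
  rw [mul_pow] at hq
  refine le_trans (mul_le_mul_of_nonneg_left ?_ (by positivity)) hq
  refine le_trans ?_ hb
  have hjk : (j : ℝ) ≤ S.k := by exact_mod_cast hj
  have := S.k_mul_eps_le
  nlinarith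

theorem half_pow_k_le : (1 / 2 : ℝ) ^ S.k ≤ x ^ 2 / 2 ^ 18 := by
  have h := S.hk
  rw [le_div_iff₀ (by positivity), one_div, inv_pow, inv_mul_le_iff₀ (by positivity)]
  exact h

theorem quarter_pow_le : (1 / 4 : ℝ) ^ S.k ≤ 1 / 2 :=
  (pow_le_of_le_one (by norm_num) (by norm_num) S.k_pos.ne').trans (by norm_num)

theorem half_pow_le (h1 : 2 - S.eps ≤ q) : 2 ^ S.k / 2 ≤ q ^ S.k := by
  have := pow_ge h1 le_rfl
  have := S.quarter_pow_le
  have : (0 : ℝ) < 2 ^ S.k := by positivity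
  nlinarith

theorem blockVal_bounds (h1 : 2 - S.eps ≤ q) (h2 : q ≤ 2) {u : ℕ} (hu : u < 2 ^ S.k) :
    u - (1 / 2) ^ S.k ≤ blockVal S.k u q ∧ blockVal S.k u q ≤ u := by
  have hq := three_halves_le h1
  constructor
  · have hd : blockVal S.k u 2 - blockVal S.k u q ≤ (1 / 2) ^ S.k := by
      rw [blockVal, blockVal, ← Finset.sum_sub_distrib]
      calc ∑ j ∈ Finset.range S.k, (((u / 2 ^ j % 2 : ℕ) : ℝ) * 2 ^ j -
              ((u / 2 ^ j % 2 : ℕ) : ℝ) * q ^ j)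
          ≤ ∑ j ∈ Finset.range S.k, 2 ^ j * (1 / 4 : ℝ) ^ S.k := by
            refine Finset.sum_le_sum fun j hj => ?_
            have hp := pow_ge h1 (Finset.mem_range.1 hj).le
            have h0 : (0 : ℝ) < 2 ^ j * (1 / 4) ^ S.k := by positivity
            rw [← mul_sub]
            rcases Nat.mod_two_eq_zero_or_one (u / 2 ^ j) with h | h <;> rw [h]
            · simp
            · push_cast
              linarith
        _ ≤ 2 ^ S.k * (1 / 4 : ℝ) ^ S.k := by
            rw [← Finset.sum_mul]
            refine mul_le_mul_of_nonneg_right ?_ (by positivity)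
            have := Nat.geomSum_lt (m := 2) (n := S.k) (s := Finset.range S.k) le_rfl
              (fun j hj => Finset.mem_range.1 hj)
            exact_mod_cast this.le
        _ = (1 / 2) ^ S.k := by rw [← mul_pow]; norm_num
    rw [blockVal_two hu] at hd
    linarith
  · conv_rhs => rw [← blockVal_two hu]
    exact Finset.sum_le_sum fun j _ => by gcongr

/-- The smallest tail, consisting of the blocks `0 ⋯ 0 1`, has a small value. -/
theorem expVal_min_le (h1 : 2 - S.eps ≤ q) (h2 : q ≤ 2) :
    expVal (blockDigit S.k fun _ => 1) q ≤ 6 * (1 / 2) ^ S.k := by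
  have hq := three_halves_le h1
  have hk : 1 < 2 ^ S.k := Nat.one_lt_two_pow S.k_pos.ne'
  rw [expVal_blockDigit S.k_pos _ (by linarith), div_le_iff₀ (by positivity)]
  have hb := (blockVal_bounds h1 h2 hk).2
  have hv := expVal_le (blockDigit S.k fun _ => 1) (show 1 < q by linarith)
  have hv2 : 1 / (q - 1) ≤ 2 := by
    rw [div_le_iff₀ (by linarith)]; linarith
  have hp := half_pow_le h1
  have e : (1 / 2 : ℝ) ^ S.k * 2 ^ S.k = 1 := by rw [← mul_pow]; norm_num
  have := mul_le_mul_of_nonneg_left hp (show (0 : ℝ) ≤ 6 * (1 / 2) ^ S.k by positivity)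
  push_cast at hb
  linarith

/-- The largest tail, consisting of the blocks `1 ⋯ 1 0`, has a value close to `1`. -/
theorem le_expVal_max (h1 : 2 - S.eps ≤ q) (h2 : q ≤ 2) :
    1 - 3 * (1 / 2) ^ S.k ≤ expVal (blockDigit S.k fun _ => 2 ^ S.k - 2) q := by
  have hq := three_halves_le h1
  have hk : 2 ≤ 2 ^ S.k := Nat.one_lt_two_pow S.k_pos.ne'
  rw [expVal_blockDigit S.k_pos _ (by linarith)]
  have hb := (blockVal_bounds h1 h2 (u := 2 ^ S.k - 2) (by omega)).1
  rw [Nat.cast_sub hk] at hb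
  have hv := expVal_nonneg (blockDigit S.k fun _ => 2 ^ S.k - 2) (show 1 < q by linarith)
  have e : (1 / 2 : ℝ) ^ S.k * 2 ^ S.k = 1 := by rw [← mul_pow]; norm_num
  have hp : q ^ S.k ≤ 2 ^ S.k := pow_le_pow_left₀ (by linarith) h2 _
  have hl : (1 / 2 : ℝ) ^ S.k ≤ 1 / 2 :=
    pow_le_of_le_one (by norm_num) (by norm_num) S.k_pos.ne'
  push_cast at hb
  have hk' : (2 : ℝ) ≤ 2 ^ S.k := by exact_mod_cast hk
  have hpos : (0 : ℝ) < q ^ S.k := by positivity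
  rw [le_div_iff₀ hpos]
  have h3 : (1 - 3 * (1 / 2 : ℝ) ^ S.k) * q ^ S.k ≤ 2 ^ S.k - 3 := by
    rcases le_total 0 (1 - 3 * (1 / 2 : ℝ) ^ S.k) with h | h
    · have := mul_le_mul_of_nonneg_left hp h
      linarith
    · have hx := S.half_pow_k_le
      have := S.x_le
      have := S.x_pos
      nlinarith
  linarith

end Setup

/-! ### Bases with prescribed blocks -/

namespace Setup

variable {x : ℝ} (S : Setup x)

/-- The digit sequence `t_0 ⋯ t_(m-1) 0` followed by the blocks `b 0, b 1, …`. -/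
def digits (b : ℕ → ℕ) (i : ℕ) : Fin 2 :=
  if i < S.m then S.t i else if i = S.m then 0 else blockDigit S.k b (i - (S.m + 1))

/-- `q` is a base close to `2` in which `x` has the expansion with blocks `b`. -/
structure IsRoot (b : ℕ → ℕ) (q : ℝ) : Prop where
  ge : 2 - S.eps ≤ q
  le : q ≤ 2
  eq : expVal (S.digits b) q = x

variable {S} {b b' : ℕ → ℕ} {q q' : ℝ}

theorem digits_of_lt {i : ℕ} (h : i < S.m) : S.digits b i = S.t i := if_pos h

theorem digits_m : S.digits b S.m = 0 := by simp [digits]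

theorem digits_add (b : ℕ → ℕ) (i : ℕ) : S.digits b (S.m + 1 + i) = blockDigit S.k b i := by
  rw [digits, if_neg (by omega), if_neg (by omega), Nat.add_sub_cancel_left]

theorem digits_add_mul (b : ℕ → ℕ) (n i : ℕ) :
    S.digits b (S.m + 1 + S.k * n + i) = blockDigit S.k (fun j => b (n + j)) i := by
  rw [add_assoc, digits_add, blockDigit_add S.k_pos]

theorem sum_t (S : Setup x) (n : ℕ) :
    ∑ i ∈ Finset.range n, ((S.t i : ℕ) : ℝ) / 2 ^ (i + 1) = x - S.y n / 2 ^ n := by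
  induction n with
  | zero => simp [S.y_zero]
  | succ n ih =>
    rw [Finset.sum_range_succ, ih, S.y_succ, pow_succ]
    field_simp
    ring

theorem expVal_digits_two (b : ℕ → ℕ) : expVal (S.digits b) 2 =
    x - S.y S.m / 2 ^ S.m + expVal (blockDigit S.k b) 2 / 2 ^ (S.m + 1) := by
  rw [expVal_split _ one_lt_two (S.m + 1), Finset.sum_range_succ, digits_m,
    Finset.sum_congr rfl (fun i hi => by rw [digits_of_lt (Finset.mem_range.1 hi)]), sum_t]
  simp only [digits_add]
  simp

theorem expVal_digits_two_lt (b : ℕ → ℕ) : expVal (S.digits b) 2 < x := by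
  rw [expVal_digits_two]
  have h := expVal_le (blockDigit S.k b) one_lt_two
  have hy := S.half_lt
  norm_num at h
  have : expVal (blockDigit S.k b) 2 / 2 ^ (S.m + 1) < S.y S.m / 2 ^ S.m := by
    rw [pow_succ, div_lt_div_iff₀ (by positivity) (by positivity)]
    have : (0 : ℝ) < 2 ^ S.m := by positivity
    nlinarith
  linarith

theorem exists_root (S : Setup x) (b : ℕ → ℕ) : ∃ q, S.IsRoot b q := by
  have he := S.eps_pos
  have he2 := S.eps_le_eighth
  have hx := S.x_pos
  have hlow : x ≤ expVal (S.digits b) (2 - S.eps) := by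
    have h := mul_expVal_le (S.digits b) (p := 2 - S.eps) (q := 2) (by linarith) (by linarith)
    have h2 := expVal_digits_two (S := S) b
    have h3 := expVal_nonneg (blockDigit S.k b) one_lt_two
    have h4 : S.y S.m / 2 ^ S.m ≤ 1 / 2 ^ S.m :=
      div_le_div_of_nonneg_right (S.y_le _) (by positivity)
    have h5 : 0 ≤ expVal (blockDigit S.k b) 2 / 2 ^ (S.m + 1) := by positivity
    have h6 : x * S.eps = 2 * (1 / 2 ^ S.m) := by
      rw [S.eps_eq]; field_simp
    have h7 : (2 - S.eps) * x ≤ (2 - S.eps) * expVal (S.digits b) (2 - S.eps) := by linarith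
    exact le_of_mul_le_mul_left h7 (by linarith)
  obtain ⟨q, hq, hq2⟩ := intermediate_value_Icc' (show 2 - S.eps ≤ 2 by linarith)
    ((continuousOn_expVal (S.digits b)).mono fun z hz => three_halves_le hz.1)
    ⟨(expVal_digits_two_lt b).le, hlow⟩
  exact ⟨q, hq.1, hq.2, hq2⟩

/-- The bases with valid blocks are univoque: all tails of the expansion stay off the region
where both digits are possible. -/
theorem IsRoot.mem_univoqueBases (h : S.IsRoot b q) (hb : ValidBlocks S.k b) :
    q ∈ univoqueBases x := by
  have hq := three_halves_le h.ge
  have hq1 : 1 < q := by linarith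
  have he := S.eps_pos
  have hq2 : q < 2 := by
    refine lt_of_le_of_ne h.le ?_
    rintro rfl
    exact (expVal_digits_two_lt b).ne h.eq
  have hδ : (2 - q) / (q - 1) ≤ 2 * S.eps := by
    rw [div_le_iff₀ (by linarith)]
    have := h.ge
    nlinarith
  have hid : 1 / (q - 1) = 1 + (2 - q) / (q - 1) := by
    have : q - 1 ≠ 0 := by linarith
    field_simp
    ring
  have hpow : ∀ j : ℕ, (1 / 2 : ℝ) ^ j ≤ 1 / q ^ j := fun j => by
    rw [one_div, inv_pow, one_div]
    exact inv_anti₀ (by positivity) (pow_le_pow_left₀ (by linarith) h.le j)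
  -- tails inside the blocks
  have hblock : ∀ i, (2 - q) / (q - 1) < expVal (fun j => S.digits b (S.m + 1 + i + j)) q ∧
      expVal (fun j => S.digits b (S.m + 1 + i + j)) q < 1 := by
    intro i
    have hfun : (fun j => S.digits b (S.m + 1 + i + j)) = fun j => blockDigit S.k b (i + j) := by
      funext j
      rw [add_assoc, digits_add]
    rw [hfun]
    have hlt : ∀ j < 2 * S.k, (2 - q) / (q - 1) < 1 / q ^ (j + 1) := by
      intro j hj
      refine hδ.trans_lt (lt_of_lt_of_le ?_ (hpow (j + 1)))
      have e1 : (1 / 2 : ℝ) ^ (2 * S.k) ≤ (1 / 2) ^ (j + 1) :=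
        pow_le_pow_of_le_one (by norm_num) (by norm_num) (by omega)
      have e2 : (1 / 8 : ℝ) ^ S.k = (1 / 2) ^ S.k * (1 / 2) ^ (2 * S.k) := by
        rw [pow_mul, ← mul_pow]; norm_num
      have e3 := S.eps_le
      have e4 := S.half_pow_k_le
      have e5 : x ^ 2 ≤ 1 := pow_le_one₀ S.x_pos.le S.x_le
      have e6 : (0 : ℝ) < (1 / 2) ^ (2 * S.k) := by positivity
      rw [e2] at e3
      nlinarith
    constructor
    · obtain ⟨j, hj, hj1⟩ := exists_blockDigit_eq hb 1 i
      exact (hlt j hj).trans_le (one_div_pow_le_expVal _ hq1 (j := j) hj1)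
    · obtain ⟨j, hj, hj0⟩ := exists_blockDigit_eq hb 0 i
      have := expVal_le_sub (fun j => blockDigit S.k b (i + j)) hq1 (j := j) hj0
      have := hlt j hj
      linarith
  -- tails inside the prefix are bounded by the tails of the expansion in base `2`
  have hpre : ∀ n ≤ S.m, expVal (fun j => S.digits b (n + j)) q ≤ S.y n ∧
      (n < S.m → expVal (fun j => S.digits b (n + 1 + j)) q < S.y (n + 1)) := by
    have hstep : ∀ n, expVal (fun j => S.digits b (n + j)) q ≤ S.y n → n < S.m →
        expVal (fun j => S.digits b (n + 1 + j)) q < S.y (n + 1) := by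
      intro n hn hnm
      have e := expVal_succ (S.digits b) hq1 n
      rw [digits_of_lt hnm] at e
      have := S.y_succ n
      have := S.y_pos n
      nlinarith
    intro n
    induction n with
    | zero =>
      intro _
      have : expVal (fun j => S.digits b (0 + j)) q ≤ S.y 0 := by
        simp only [zero_add]
        rw [S.y_zero, h.eq]
      exact ⟨this, hstep 0 this⟩
    | succ n ih =>
      intro hn
      have := (ih (by omega)).2 (by omega)
      exact ⟨this.le, hstep _ this.le⟩
  refine ⟨hq1, h.le, S.digits b, (isExpansion_iff hq1).2 h.eq, fun d' hd' => ?_⟩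
  refine eq_of_expVal_eq hq1 ?_ ?_ (((isExpansion_iff hq1).1 hd').trans h.eq.symm)
  · intro n hn
    rcases lt_or_ge n S.m with hnm | hnm
    · exact ((hpre n hnm.le).2 hnm).trans_le (S.y_le _)
    · have := (hblock (n - S.m)).2
      rwa [show S.m + 1 + (n - S.m) = n + 1 by omega] at this
  · intro n hn
    rcases lt_or_ge n S.m with hnm | hnm
    · rw [digits_of_lt hnm] at hn
      rcases S.tail n hnm hn with ⟨j, hj1, hj2, hj3, hj4⟩ | htail
      · have := one_div_pow_le_expVal (fun i => S.digits b (n + 1 + i)) hq1 (j := j - n - 1)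
          (by rw [show n + 1 + (j - n - 1) = j by omega, digits_of_lt hj2, hj3])
        rw [show j - n - 1 + 1 = j - n by omega] at this
        linarith [hpow (j - n)]
      · obtain ⟨j, hj, hj1⟩ := exists_blockDigit_eq_one hb
        have := one_div_pow_le_expVal (fun i => S.digits b (n + 1 + i)) hq1
          (j := S.m + j - n) (by
            rw [show n + 1 + (S.m + j - n) = S.m + 1 + j by omega, digits_add, hj1])
        have h2 := hpow (S.m + j - n + 1)
        have h3 : (1 / 2 : ℝ) ^ (S.m + S.k - n) ≤ (1 / 2) ^ (S.m + j - n + 1) :=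
          pow_le_pow_of_le_one (by norm_num) (by norm_num) (by omega)
        linarith
    · have := (hblock (n - S.m)).1
      rwa [show S.m + 1 + (n - S.m) = n + 1 by omega] at this

/-- The set of bases whose expansions of `x` have valid blocks. -/
def baseSet (S : Setup x) : Set ℝ :=
  {q | ∃ b, ValidBlocks S.k b ∧ S.IsRoot b q}

theorem baseSet_subset (S : Setup x) : S.baseSet ⊆ univoqueBases x :=
  fun _ ⟨_, hb, h⟩ => h.mem_univoqueBases hb

theorem baseSet_subset_Icc (S : Setup x) : S.baseSet ⊆ Set.Icc (3 / 2) 2 :=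
  fun _ ⟨_, _, h⟩ => ⟨three_halves_le h.ge, h.le⟩

theorem continuous_digits (S : Setup x) (i : ℕ) :
    Continuous (fun b : ℕ → ℕ => ((S.digits b i : ℕ) : ℝ)) := by
  have : (fun b : ℕ → ℕ => ((S.digits b i : ℕ) : ℝ)) =
      (fun u : ℕ => ((S.digits (fun _ => u) i : ℕ) : ℝ)) ∘
        fun b : ℕ → ℕ => b ((i - (S.m + 1)) / S.k) := by
    funext b
    simp [digits, blockDigit]
  rw [this]
  exact continuous_of_discreteTopology.comp (continuous_apply _)

theorem isCompact_baseSet (S : Setup x) : IsCompact S.baseSet := by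
  set C : Set (ℝ × (ℕ → ℕ)) :=
    Set.Icc (2 - S.eps) 2 ×ˢ Set.univ.pi fun _ => Set.Icc 1 (2 ^ S.k - 2) with hC
  have hCc : IsCompact C :=
    isCompact_Icc.prod (isCompact_univ_pi fun _ => (Set.finite_Icc _ _).isCompact)
  have hcont : ContinuousOn (fun p : ℝ × (ℕ → ℕ) => expVal (S.digits p.2) p.1) C := by
    have h1 : (1 : ℝ) < 3 / 2 := by norm_num
    refine continuousOn_tsum (u := fun i => 1 / (3 / 2 : ℝ) ^ (i + 1)) (fun i => ?_)
      (hasSum_one_div_pow_succ h1).summable ?_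
    · refine ContinuousOn.div ((S.continuous_digits i).comp continuous_snd).continuousOn
        (continuous_fst.pow _).continuousOn fun p hp => ?_
      have := three_halves_le hp.1.1
      positivity
    · intro i p hp
      have := three_halves_le hp.1.1
      rw [Real.norm_of_nonneg (by positivity)]
      refine (digit_div_le (by linarith) _ i).trans ?_
      gcongr
  have hK : S.baseSet =
      Prod.fst '' (C ∩ (fun p : ℝ × (ℕ → ℕ) => expVal (S.digits p.2) p.1) ⁻¹' {x}) := by
    ext q
    constructor
    · rintro ⟨b, hb, h⟩
      refine ⟨(q, b), ⟨⟨⟨h.ge, h.le⟩, fun j _ => ⟨(hb j).1, ?_⟩⟩, h.eq⟩, rfl⟩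
      have := (hb j).2
      change b j ≤ _
      omega
    · rintro ⟨⟨q, b⟩, ⟨⟨⟨h1, h2⟩, hb⟩, h3⟩, rfl⟩
      refine ⟨b, fun j => ?_, h1, h2, h3⟩
      have := hb j (Set.mem_univ _)
      have h4 : 1 ≤ b j := this.1
      have h5 : b j ≤ 2 ^ S.k - 2 := this.2
      omega
  rw [hK]
  exact (hCc.of_isClosed_subset
    (hcont.preimage_isClosed_of_isClosed hCc.isClosed isClosed_singleton)
    Set.inter_subset_left).image continuous_fst

end Setup

/-! ### Comparison of bases with common blocks -/

namespace Setup

variable {x : ℝ} {S : Setup x} {b b' : ℕ → ℕ} {q q' : ℝ} {n : ℕ}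

theorem expVal_digits_sub (h : ∀ j < n, b j = b' j) (hq : 1 < q) :
    expVal (S.digits b') q - expVal (S.digits b) q =
      (expVal (blockDigit S.k fun j => b' (n + j)) q -
        expVal (blockDigit S.k fun j => b (n + j)) q) / q ^ (S.m + 1 + S.k * n) := by
  rw [expVal_split (S.digits b') hq (S.m + 1 + S.k * n),
    expVal_split (S.digits b) hq (S.m + 1 + S.k * n)]
  simp only [digits_add_mul]
  have : ∀ i ∈ Finset.range (S.m + 1 + S.k * n), S.digits b' i = S.digits b i := by
    intro i hi
    have hi := Finset.mem_range.1 hi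
    unfold digits
    split_ifs with h1 h2
    · rfl
    · rfl
    · have : (i - (S.m + 1)) / S.k < n := by
        rw [Nat.div_lt_iff_lt_mul S.k_pos, mul_comm]
        omega
      simp only [blockDigit, h _ this]
  rw [Finset.sum_congr rfl fun i hi => by rw [this i hi]]
  ring

theorem IsRoot.sub_le (h : S.IsRoot b q) (h' : S.IsRoot b' q') {c : ℝ} (hc : 0 ≤ c)
    (hd : expVal (S.digits b') q - x ≤ c) : q' - q ≤ 2 / x * c := by
  have hx := S.x_pos
  rcases le_total q' q with hle | hle
  · have : 0 ≤ 2 / x * c := by positivity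
    linarith
  · have hq := three_halves_le h.ge
    have h1 := mul_expVal_le (S.digits b') (p := q) (by linarith) hle
    rw [h'.eq] at h1
    have h2 := h.le
    rw [div_mul_eq_mul_div, le_div_iff₀ hx]
    nlinarith

theorem IsRoot.le_sub (h : S.IsRoot b q) (h' : S.IsRoot b' q') {c : ℝ} (hc : 0 < c)
    (hd : c ≤ expVal (S.digits b') q - x) : c ≤ 4 * (q' - q) := by
  have hq' := three_halves_le h'.ge
  rcases le_total q q' with hle | hle
  · have h1 := expVal_sub_le (S.digits b') (three_halves_le h.ge) hle
    rw [h'.eq] at h1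
    linarith
  · have h1 := expVal_anti (S.digits b') (by linarith) hle
    rw [h'.eq] at h1
    linarith

theorem expVal_le_two (d : ℕ → Fin 2) (hq : 3 / 2 ≤ q) : expVal d q ≤ 2 := by
  refine (expVal_le d (by linarith)).trans ?_
  rw [div_le_iff₀ (by linarith)]
  linarith

theorem IsRoot.sub_le_of_agree (h : S.IsRoot b q) (h' : S.IsRoot b' q')
    (hb : ∀ j < n, b j = b' j) : q' - q ≤ 4 / (x * q ^ (S.m + 1 + S.k * n)) := by
  have hq := three_halves_le h.ge
  have hd := expVal_digits_sub (S := S) hb (q := q) (by linarith)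
  rw [h.eq] at hd
  have h1 := h.sub_le h' (c := 2 / q ^ (S.m + 1 + S.k * n)) (by positivity) (by
    rw [hd]
    gcongr
    linarith [expVal_le_two (blockDigit S.k fun j => b' (n + j)) hq,
      expVal_nonneg (blockDigit S.k fun j => b (n + j)) (show 1 < q by linarith)])
  refine h1.trans (le_of_eq ?_)
  have := S.x_pos
  field_simp
  norm_num

/-- The scale `q ^ (-N)` belonging to a common prefix of length `N` depends on the base only up to
a factor `2`. -/
theorem IsRoot.one_div_pow_le (h : S.IsRoot b q) (h' : S.IsRoot b' q')
    (hb : ∀ j < n, b j = b' j) :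
    1 / q ^ (S.m + 1 + S.k * n) ≤ 2 * (1 / q' ^ (S.m + 1 + S.k * n)) := by
  have hq := three_halves_le h.ge
  have hq' := three_halves_le h'.ge
  have hsub := h.sub_le_of_agree h' hb
  have hlarge := S.large (S.m + 1 + S.k * n) (by omega)
  have hx := S.x_pos
  set N := S.m + 1 + S.k * n
  suffices hs : q' ^ N ≤ 2 * q ^ N by
    rw [mul_one_div, div_le_div_iff₀ (by positivity) (by positivity)]
    linarith
  rcases le_total q' q with hle | hle
  · have h1 : q' ^ N ≤ q ^ N := pow_le_pow_left₀ (by linarith) hle N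
    have : 0 < q ^ N := by positivity
    linarith
  · have hber := one_add_mul_le_pow (a := -((q' - q) / q')) (by
      have : (q' - q) / q' ≤ 1 := by rw [div_le_one (by linarith)]; linarith
      linarith) N
    have e : 1 + -((q' - q) / q') = q / q' := by field_simp; ring
    rw [e, div_pow] at hber
    have hN : (N : ℝ) * ((q' - q) / q') ≤ 1 / 2 := by
      have h1 : (q' - q) / q' ≤ q' - q := div_le_self (by linarith) (by linarith)
      have h2 : (3 / 2 : ℝ) ^ N ≤ q ^ N := pow_le_pow_left₀ (by norm_num) hq N
      have h3 : (N : ℝ) * (4 / (x * q ^ N)) ≤ 1 / 2 := by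
        rw [mul_div_assoc', div_le_iff₀ (by positivity)]
        nlinarith
      exact (mul_le_mul_of_nonneg_left (h1.trans hsub) (by positivity)).trans h3
    have h4 : 1 / 2 ≤ q ^ N / q' ^ N := by linarith
    rw [le_div_iff₀ (by positivity)] at h4
    linarith

/-! ### The intervals of bases -/

/-- The smallest block sequence which agrees with `b` before the index `n`. -/
def lo (n : ℕ) (b : ℕ → ℕ) (j : ℕ) : ℕ := if j < n then b j else 1

/-- The largest block sequence which agrees with `b` before the index `n`. -/
def hi (S : Setup x) (n : ℕ) (b : ℕ → ℕ) (j : ℕ) : ℕ := if j < n then b j else 2 ^ S.k - 2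

theorem lo_of_lt {j : ℕ} (h : j < n) : lo n b j = b j := if_pos h

theorem hi_of_lt {j : ℕ} (h : j < n) : S.hi n b j = b j := if_pos h

theorem lo_add (j : ℕ) : lo n b (n + j) = 1 := if_neg (by omega)

theorem hi_add (j : ℕ) : S.hi n b (n + j) = 2 ^ S.k - 2 := if_neg (by omega)

theorem four_le_two_pow (S : Setup x) : 4 ≤ 2 ^ S.k := by
  have h := S.half_pow_k_le
  have h5 : x ^ 2 ≤ 1 := pow_le_one₀ S.x_pos.le S.x_le
  rw [one_div, inv_pow] at h
  have h6 : ((2 : ℝ) ^ S.k)⁻¹ ≤ (4 : ℝ)⁻¹ := h.trans (by norm_num; linarith)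
  have h7 : (4 : ℝ) ≤ 2 ^ S.k := (inv_le_inv₀ (by positivity) (by norm_num)).1 h6
  exact_mod_cast h7

theorem ValidBlocks.lo (hb : ValidBlocks S.k b) (n : ℕ) : ValidBlocks S.k (lo n b) := by
  intro j
  have := S.four_le_two_pow
  have := hb j
  unfold Setup.lo
  split_ifs <;> omega

theorem ValidBlocks.hi (hb : ValidBlocks S.k b) (n : ℕ) : ValidBlocks S.k (S.hi n b) := by
  intro j
  have := S.four_le_two_pow
  have := hb j
  unfold Setup.hi
  split_ifs <;> omega

theorem ValidBlocks.update (hb : ValidBlocks S.k b) (n : ℕ) {u : ℕ} (h1 : 1 ≤ u)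
    (h2 : u + 2 ≤ 2 ^ S.k) : ValidBlocks S.k (Function.update b n u) := by
  intro j
  rcases eq_or_ne j n with rfl | h
  · simpa using ⟨h1, h2⟩
  · simpa [Function.update_of_ne h] using hb j

theorem lo_update_one (n : ℕ) (b : ℕ → ℕ) : lo (n + 1) (Function.update b n 1) = lo n b := by
  funext j
  unfold lo
  rcases lt_trichotomy j n with h | rfl | h
  · rw [if_pos (by omega), if_pos h, Function.update_of_ne h.ne]
  · simp
  · rw [if_neg (by omega), if_neg (by omega)]

theorem hi_update_max (S : Setup x) (n : ℕ) (b : ℕ → ℕ) :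
    S.hi (n + 1) (Function.update b n (2 ^ S.k - 2)) = S.hi n b := by
  funext j
  unfold hi
  rcases lt_trichotomy j n with h | rfl | h
  · rw [if_pos (by omega), if_pos h, Function.update_of_ne h.ne]
  · simp
  · rw [if_neg (by omega), if_neg (by omega)]

theorem half_pow_small (S : Setup x) : (1 / 2 : ℝ) ^ S.k ≤ x / 2 ^ 18 := by
  have h := S.half_pow_k_le
  have h1 := S.x_le
  have h2 := S.x_pos
  have h5 : x ^ 2 ≤ x := by nlinarith
  refine h.trans ?_
  gcongr

theorem interval_length (hL : S.IsRoot (lo n b) q) (hR : S.IsRoot (S.hi n b) q') :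
    1 / 8 * (1 / q ^ (S.m + 1 + S.k * n)) ≤ q' - q ∧
      q' - q ≤ 4 / x * (1 / q ^ (S.m + 1 + S.k * n)) := by
  have hq := three_halves_le hL.ge
  have hag : ∀ j < n, lo n b j = S.hi n b j := fun j hj => by rw [lo_of_lt hj, hi_of_lt hj]
  constructor
  · have hd := expVal_digits_sub (S := S) hag (q := q) (by linarith)
    simp only [lo_add, hi_add] at hd
    rw [hL.eq] at hd
    have h1 := expVal_min_le hL.ge hL.le
    have h2 := le_expVal_max hL.ge hL.le
    have h3 := S.half_pow_small
    have h4 := S.x_le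
    have := hL.le_sub hR (c := 1 / 2 / q ^ (S.m + 1 + S.k * n)) (by positivity) (by
      rw [hd]
      gcongr
      linarith)
    have e : 1 / 2 / q ^ (S.m + 1 + S.k * n) = 1 / 2 * (1 / q ^ (S.m + 1 + S.k * n)) := by ring
    rw [e] at this
    linarith
  · refine (hL.sub_le_of_agree hR hag).trans (le_of_eq ?_)
    have := S.x_pos
    field_simp

/-- The intervals of consecutive blocks `u` and `u + 1` are separated by a gap of relative length
`O(2 ^ (-k))`. -/
theorem gap_le {u : ℕ} (hu : u + 3 ≤ 2 ^ S.k)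
    (hR : S.IsRoot (S.hi (n + 1) (Function.update b n u)) q)
    (hL : S.IsRoot (lo (n + 1) (Function.update b n (u + 1))) q') :
    q' - q ≤ 64 / x * (1 / 4) ^ S.k * (1 / q ^ (S.m + 1 + S.k * n)) := by
  have hq := three_halves_le hR.ge
  have hag : ∀ j < n, S.hi (n + 1) (Function.update b n u) j =
      lo (n + 1) (Function.update b n (u + 1)) j := fun j hj => by
    rw [lo_of_lt (by omega), hi_of_lt (by omega), Function.update_of_ne hj.ne,
      Function.update_of_ne hj.ne]
  have hd := expVal_digits_sub (S := S) hag (q := q) (by linarith)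
  have key : ∀ c : ℕ → ℕ, expVal (blockDigit S.k fun j => c (n + j)) q =
      (blockVal S.k (c n) q + expVal (blockDigit S.k fun j => c (n + 1 + j)) q) / q ^ S.k := by
    intro c
    rw [expVal_blockDigit S.k_pos _ (by linarith)]
    simp only [add_zero, add_assoc, add_comm 1]
  rw [hR.eq, key, key, ← sub_div] at hd
  simp only [lo_add, hi_add, lo_of_lt (Nat.lt_succ_self n), hi_of_lt (Nat.lt_succ_self n),
    Function.update_self] at hd
  have h1 := expVal_min_le hR.ge hR.le
  have h2 := le_expVal_max hR.ge hR.le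
  have h3 := (blockVal_bounds hR.ge hR.le (u := u) (by omega)).1
  have h4 := (blockVal_bounds hR.ge hR.le (u := u + 1) (by omega)).2
  push_cast at h4
  have hk := half_pow_le hR.ge
  have e : (1 / 2 : ℝ) ^ S.k * 2 ^ S.k = 1 := by rw [← mul_pow]; norm_num
  have e4 : (1 / 4 : ℝ) ^ S.k = (1 / 2) ^ S.k * (1 / 2) ^ S.k := by rw [← mul_pow]; norm_num
  have hnum : ∀ z : ℝ, z ≤ 10 * (1 / 2) ^ S.k → z / q ^ S.k ≤ 32 * (1 / 4) ^ S.k := by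
    intro z hz
    rw [div_le_iff₀ (by positivity), e4]
    have hp : (0 : ℝ) < (1 / 2) ^ S.k := by positivity
    have := mul_le_mul_of_nonneg_left hk (show (0 : ℝ) ≤ 32 * (1 / 2) ^ S.k * (1 / 2) ^ S.k by
      positivity)
    nlinarith
  have := hR.sub_le hL (c := 32 * (1 / 4) ^ S.k / q ^ (S.m + 1 + S.k * n)) (by positivity) (by
    rw [hd]
    refine div_le_div_of_nonneg_right (hnum _ ?_) (by positivity)
    linarith)
  refine this.trans (le_of_eq ?_)
  have := S.x_pos
  field_simp
  norm_num

/-- The base in which `x` has the expansion with blocks `b`. -/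
noncomputable def root (S : Setup x) (b : ℕ → ℕ) : ℝ := (S.exists_root b).choose

theorem isRoot_root (S : Setup x) (b : ℕ → ℕ) : S.IsRoot b (S.root b) :=
  (S.exists_root b).choose_spec

/-- For a function `φ` with difference quotients between `1 / 2` and `1`, the `φ`-images of the
hulls of the bases with `n` prescribed blocks form a thick family. -/
theorem isThick (S : Setup x) {φ : ℝ → ℝ} (hφ : ∀ p q, 3 / 2 ≤ p → p ≤ q → q ≤ 2 →
      (q - p) / 2 ≤ φ q - φ p ∧ φ q - φ p ≤ q - p) :
    IsThick (x / 128 * (1 / 2) ^ S.k)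
      (fun w : ℕ × {b // ValidBlocks S.k b} => φ (S.root (lo w.1 w.2.1)))
      (fun w => φ (S.root (S.hi w.1 w.2.1))) := by
  have hφ' : ∀ b b', S.root b ≤ S.root b' →
      (S.root b' - S.root b) / 2 ≤ φ (S.root b') - φ (S.root b) ∧
        φ (S.root b') - φ (S.root b) ≤ S.root b' - S.root b := fun b b' h =>
    hφ _ _ (three_halves_le (S.isRoot_root b).ge) h (S.isRoot_root b').le
  have hx := S.x_pos
  have hlen : ∀ n b, S.root (lo n b) ≤ S.root (S.hi n b) ∧
      1 / 16 * (1 / S.root (lo n b) ^ (S.m + 1 + S.k * n)) ≤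
        φ (S.root (S.hi n b)) - φ (S.root (lo n b)) ∧
      φ (S.root (S.hi n b)) - φ (S.root (lo n b)) ≤
        4 / x * (1 / S.root (lo n b) ^ (S.m + 1 + S.k * n)) := by
    intro n b
    have hl := interval_length (S.isRoot_root (lo n b)) (S.isRoot_root (S.hi n b))
    have h0 := three_halves_le (S.isRoot_root (lo n b)).ge
    have hp : 0 < 1 / S.root (lo n b) ^ (S.m + 1 + S.k * n) := by positivity
    have hle : S.root (lo n b) ≤ S.root (S.hi n b) := by linarith
    have := hφ' _ _ hle
    exact ⟨hle, by linarith, by linarith⟩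
  refine ⟨fun ⟨n, b, hb⟩ => ?_, fun ⟨n, b, hb⟩ s h hh hs1 hs2 => ?_⟩
  · have := (hlen n b).2.1
    have h0 := three_halves_le (S.isRoot_root (lo n b)).ge
    have hp : 0 < 1 / S.root (lo n b) ^ (S.m + 1 + S.k * n) := by positivity
    simp only
    linarith
  · simp only at hh hs1 hs2
    set E := 1 / S.root (lo n b) ^ (S.m + 1 + S.k * n) with hE
    set δ : ℝ := (1 / 2) ^ S.k with hδ
    obtain ⟨-, hlow, hupp⟩ := hlen n b
    have hL0 := three_halves_le (S.isRoot_root (lo n b)).ge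
    have hEpos : 0 < E := by positivity
    have hδpos : 0 < δ := by positivity
    have hδx : δ ≤ x / 2 ^ 18 := S.half_pow_small
    have h4 := S.four_le_two_pow
    have hfac : x / 128 * δ * (4 / x * E) = δ * E / 32 := by field_simp; norm_num
    -- length of the subinterval of the block `u`
    have hsub : ∀ u, x / 128 * δ * (φ (S.root (S.hi n b)) - φ (S.root (lo n b))) ≤
          φ (S.root (S.hi (n + 1) (Function.update b n u))) -
            φ (S.root (lo (n + 1) (Function.update b n u))) ∧
        φ (S.root (S.hi (n + 1) (Function.update b n u))) -
            φ (S.root (lo (n + 1) (Function.update b n u))) ≤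
          (φ (S.root (S.hi n b)) - φ (S.root (lo n b))) / 2 := by
      intro u
      obtain ⟨-, clow, cupp⟩ := hlen (n + 1) (Function.update b n u)
      have hr := S.isRoot_root (lo (n + 1) (Function.update b n u))
      have hag : ∀ j < n, lo n b j = lo (n + 1) (Function.update b n u) j := fun j hj => by
        rw [lo_of_lt hj, lo_of_lt (by omega), Function.update_of_ne hj.ne]
      have hE1 := (S.isRoot_root (lo n b)).one_div_pow_le hr hag
      have hE2 := hr.one_div_pow_le (S.isRoot_root (lo n b)) (fun j hj => (hag j hj).symm)
      rw [← hE] at hE1 hE2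
      have hr0 := three_halves_le hr.ge
      set p := S.root (lo (n + 1) (Function.update b n u))
      have e : 1 / p ^ (S.m + 1 + S.k * (n + 1)) =
          1 / p ^ (S.m + 1 + S.k * n) * (1 / p ^ S.k) := by
        rw [one_div_mul_one_div, ← pow_add]
        ring_nf
      have hk1 : δ ≤ 1 / p ^ S.k := by
        rw [hδ, one_div, inv_pow, one_div]
        exact inv_anti₀ (by positivity) (pow_le_pow_left₀ (by linarith) hr.le _)
      have hk2 : 1 / p ^ S.k ≤ 2 * δ := by
        have := half_pow_le hr.ge
        have e : δ * 2 ^ S.k = 1 := by rw [hδ, ← mul_pow]; norm_num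
        rw [div_le_iff₀ (by positivity)]
        nlinarith
      rw [e] at clow cupp
      set F := 1 / p ^ (S.m + 1 + S.k * n)
      have hF : 0 < F := by positivity
      constructor
      · have h1 : x / 128 * δ * (φ (S.root (S.hi n b)) - φ (S.root (lo n b))) ≤ δ * E / 32 := by
          rw [← hfac]
          gcongr
        have h2 : E / 2 * δ ≤ F * (1 / p ^ S.k) :=
          mul_le_mul (by linarith) hk1 hδpos.le hF.le
        linarith
      · have h2 : F * (1 / p ^ S.k) ≤ (2 * E) * (2 * δ) :=
          mul_le_mul hE2 hk2 (by positivity) (by positivity)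
        have h3 : 4 / x * (F * (1 / p ^ S.k)) ≤ 4 / x * ((2 * E) * (2 * (x / 2 ^ 18))) := by
          refine mul_le_mul_of_nonneg_left (h2.trans ?_) (by positivity)
          gcongr
        have h5 : 4 / x * ((2 * E) * (2 * (x / 2 ^ 18))) = E / 2 ^ 14 := by
          field_simp
          norm_num
        rw [h5] at h3
        linarith
    -- gap to the right of the block `u`
    have hgap : ∀ u, u + 3 ≤ 2 ^ S.k → φ (S.root (lo (n + 1) (Function.update b n (u + 1)))) -
        φ (S.root (S.hi (n + 1) (Function.update b n u))) ≤ h := by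
      intro u hu
      refine le_trans ?_ hh
      have hlow' : x / 128 * δ * (1 / 16 * E) ≤
          x / 128 * δ * (φ (S.root (S.hi n b)) - φ (S.root (lo n b))) := by gcongr
      refine le_trans ?_ hlow'
      have hr := S.isRoot_root (S.hi (n + 1) (Function.update b n u))
      have hl := S.isRoot_root (lo (n + 1) (Function.update b n (u + 1)))
      rcases le_total (S.root (S.hi (n + 1) (Function.update b n u)))
        (S.root (lo (n + 1) (Function.update b n (u + 1)))) with hle | hle
      · refine (hφ' _ _ hle).2.trans ((gap_le hu hr hl).trans ?_)
        have hag : ∀ j < n, S.hi (n + 1) (Function.update b n u) j = lo n b j := fun j hj => by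
          rw [lo_of_lt hj, hi_of_lt (by omega), Function.update_of_ne hj.ne]
        have hE2 := hr.one_div_pow_le (S.isRoot_root (lo n b)) hag
        rw [← hE] at hE2
        have e4 : (1 / 4 : ℝ) ^ S.k = δ * δ := by rw [hδ, ← mul_pow]; norm_num
        calc _ ≤ 64 / x * (δ * δ) * (2 * E) := by rw [e4]; gcongr
          _ ≤ 64 / x * (δ * (x ^ 2 / 2 ^ 18)) * (2 * E) := by
              have := S.half_pow_k_le
              gcongr
          _ = x / 128 * δ * (1 / 16 * E) := by field_simp; norm_num
      · have := (hφ' _ _ hle).1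
        have : 0 ≤ x / 128 * δ * (1 / 16 * E) := by positivity
        linarith
    -- the last block whose subinterval begins at or before `s`
    let P : ℕ → Prop := fun u => φ (S.root (lo (n + 1) (Function.update b n u))) ≤ s
    classical
    have hP1 : P 1 := by
      change φ (S.root (lo (n + 1) (Function.update b n 1))) ≤ s
      rwa [lo_update_one]
    set u := Nat.findGreatest P (2 ^ S.k - 2) with hu
    have hPu : P u := Nat.findGreatest_spec (show 1 ≤ 2 ^ S.k - 2 by omega) hP1
    have hu1 : 1 ≤ u := Nat.le_findGreatest (by omega) hP1
    have hu2 : u ≤ 2 ^ S.k - 2 := Nat.findGreatest_le _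
    refine ⟨⟨n + 1, Function.update b n u, ValidBlocks.update hb n hu1 (by omega)⟩, hPu, ?_,
      (hsub u).1, (hsub u).2⟩
    rcases hu2.eq_or_lt with heq | hlt
    · simp only
      rw [heq, hi_update_max]
      exact hs2
    · have hn : ¬ P (u + 1) := Nat.findGreatest_is_greatest (Nat.lt_succ_self _) hlt
      have hn' : s < φ (S.root (lo (n + 1) (Function.update b n (u + 1)))) := not_le.1 hn
      have := hgap u (by omega)
      simp only
      linarith

end Setup

/-! ### Intervals in sums and products -/

theorem exists_Icc_subset_image_add {x : ℝ} (hx0 : 0 < x) (hx1 : x ≤ 1) {l : ℝ} (hl : l ≠ 0)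
    {φ : ℝ → ℝ} (hφ : ∀ p q, 3 / 2 ≤ p → p ≤ q → q ≤ 2 →
      (q - p) / 2 ≤ φ q - φ p ∧ φ q - φ p ≤ q - p) (hc : ContinuousOn φ (Set.Icc (3 / 2) 2)) :
    ∃ a b, a < b ∧ ∀ s ∈ Set.Icc a b, ∃ p ∈ univoqueBases x, ∃ q ∈ univoqueBases x,
      s = φ p + l * φ q := by
  obtain ⟨S⟩ := Setup.exists hx0 hx1
  have hT := S.isThick hφ
  have hx := S.x_pos
  have hρ0 : 0 < x / 128 * (1 / 2) ^ S.k := by positivity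
  have hρ1 : x / 128 * (1 / 2) ^ S.k ≤ 1 := by
    have := S.half_pow_small
    have : (0 : ℝ) < (1 / 2) ^ S.k := by positivity
    nlinarith
  have hK := S.isCompact_baseSet.image_of_continuousOn (hc.mono S.baseSet_subset_Icc)
  have hlK : IsCompact ((fun z => l * z) '' (φ '' S.baseSet)) :=
    hK.image (continuous_const.mul continuous_id)
  have hlo : ∀ w : ℕ × {b // ValidBlocks S.k b}, φ (S.root (Setup.lo w.1 w.2.1)) ∈
      φ '' S.baseSet := fun w =>
    ⟨_, ⟨_, Setup.ValidBlocks.lo w.2.2 w.1, S.isRoot_root _⟩, rfl⟩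
  have hhi : ∀ w : ℕ × {b // ValidBlocks S.k b}, φ (S.root (S.hi w.1 w.2.1)) ∈
      φ '' S.baseSet := fun w =>
    ⟨_, ⟨_, Setup.ValidBlocks.hi w.2.2 w.1, S.isRoot_root _⟩, rfl⟩
  have w₀ : ℕ × {b // ValidBlocks S.k b} :=
    ⟨0, fun _ => 1, fun _ => ⟨le_rfl, (Nat.le_succ 3).trans S.four_le_two_pow⟩⟩
  obtain ⟨a, b, hab, h⟩ : ∃ a b, a < b ∧ ∀ s ∈ Set.Icc a b, ∃ p ∈ φ '' S.baseSet,
      ∃ q ∈ (fun z => l * z) '' (φ '' S.baseSet), s = p + q := by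
    rcases lt_or_gt_of_ne hl with h | h
    · -- multiplication by `l < 0` interchanges left and right endpoints
      refine hT.exists_Icc_subset_add (hT.const_mul (neg_pos.2 h)).neg hρ0 hρ1 hK hlK hlo
        (fun w => ⟨_, hhi w, ?_⟩) w₀ w₀
      ring
    · exact hT.exists_Icc_subset_add (hT.const_mul h) hρ0 hρ1 hK hlK hlo
        (fun w => ⟨_, hlo w, rfl⟩) w₀ w₀
  refine ⟨a, b, hab, fun s hs => ?_⟩
  obtain ⟨_, ⟨p, hp, rfl⟩, _, ⟨_, ⟨q, hq, rfl⟩, rfl⟩, rfl⟩ := h s hs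
  exact ⟨p, S.baseSet_subset hp, q, S.baseSet_subset hq, rfl⟩

theorem log_sub_log_bounds (p q : ℝ) (hp : 3 / 2 ≤ p) (hpq : p ≤ q) (hq : q ≤ 2) :
    (q - p) / 2 ≤ Real.log q - Real.log p ∧ Real.log q - Real.log p ≤ q - p := by
  have hp0 : 0 < p := by linarith
  have hq0 : 0 < q := by linarith
  constructor
  · have h := Real.log_le_sub_one_of_pos (div_pos hp0 hq0)
    rw [Real.log_div hp0.ne' hq0.ne'] at h
    have : (q - p) / 2 ≤ 1 - p / q := by
      rw [one_sub_div hq0.ne']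
      exact div_le_div_of_nonneg_left (by linarith) hq0 hq
    linarith
  · have h := Real.log_le_sub_one_of_pos (div_pos hq0 hp0)
    rw [Real.log_div hq0.ne' hp0.ne'] at h
    have : q / p - 1 ≤ q - p := by
      rw [div_sub_one hp0.ne']
      exact div_le_self (by linarith) (by linarith)
    linarith

theorem theorem1p1 (x : ℝ) (hx0 : 0 < x) (hx1 : x ≤ 1) (l : ℝ) (hl : l ≠ 0) :
    (∃ a b : ℝ, a < b ∧ Set.Icc a b ⊆ algebraicSum (univoqueBases x) l) ∧
    (∃ a b : ℝ, a < b ∧ Set.Icc a b ⊆ algebraicProduct (univoqueBases x) l) := by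
  constructor
  · obtain ⟨a, b, hab, h⟩ := exists_Icc_subset_image_add hx0 hx1 hl (φ := fun z => z)
      (fun p q _ hpq _ => ⟨by linarith, le_rfl⟩) continuousOn_id
    exact ⟨a, b, hab, h⟩
  · obtain ⟨a, b, hab, h⟩ := exists_Icc_subset_image_add hx0 hx1 hl log_sub_log_bounds
      (Real.continuousOn_log.mono fun z hz => by
        have := hz.1
        exact (show (0 : ℝ) < z by linarith).ne')
    refine ⟨Real.exp a, Real.exp b, Real.exp_lt_exp.2 hab, fun z hz => ?_⟩
    have hz0 : 0 < z := (Real.exp_pos a).trans_le hz.1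
    obtain ⟨p, hp, q, hq, e⟩ := h (Real.log z)
      ⟨(Real.le_log_iff_exp_le hz0).2 hz.1, (Real.log_le_iff_le_exp hz0).2 hz.2⟩
    have hp0 : 0 < p := by linarith [hp.1]
    have hq0 : 0 < q := by linarith [hq.1]
    refine ⟨p, hp, q, hq, ?_⟩
    rw [← Real.exp_log hz0, e, Real.exp_add, Real.exp_log hp0, Real.rpow_def_of_pos hq0, mul_comm l]
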